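/- Let $n\ge 1$. For $R,S\subseteq[n]=\{1,\dots,n\}$ write $R\le S$ if $\#R=\#S$ and, for every $k$, the $k$-th smallest element of $R$ does not exceed the $k$-th smallest element of $S$. The Schubert matroid $\mathrm{SM}_n(S)$ is the matroid on $[n]$ whose bases are the sets $B\le S$; its rank function is $r_{\mathrm{SM}_n(S)}(J)=\max\{\#(J\cap B): B\le S\}$. Let $S\subseteq[n]$ and $s\in S$. Put $d=s-\#\{i\in S: i\le s\}$, $S^{(0,s)}=S$, and for $1\le k\le d$ \[ S^{(k,s)}=S^{(k-1,s)}\cup\{\max\{i: i<s,\ i\notin S^{(k-1,s)}\}\}. \] For $B\subseteq[n]$ let $\zeta^B\in\{0,1\}^n$ be its indicator vector, let \[ V=\{(\zeta^B,\,d-k)\in\mathbb R^{n+1}: 0\le k\le d,\ B\le S^{(k,s)}\}, \] and let $\mathcal P(S^{(s)})$ be the convex hull of $V$. A polytope $P\subset\mathbb R^m$ is a generalized permutahedron if there is a function $z:2^{[m]}\to\mathbb R$ with $z(\emptyset)=0$ that is submodular, i.e. $z(I)+z(J)\ge z(I\cup J)+z(I\cap J)$ for all $I,J\subseteq[m]$,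 such that \[ P=\Bigl\{t\in\mathbb R^m:\ \sum_{i\in I}t_i\le z(I)\text{ for all } I\subseteq[m],\ \sum_{i=1}^m t_i=z([m])\Bigr\}. \] Then $\mathcal P(S^{(s)})$ is a generalized permutahedron, and $\mathcal P(S^{(s)})\cap\mathbb Z^{n+1}=V$. More precisely, the function $z:2^{[n+1]}\to\mathbb R$ given by \[ z(I)=\begin{cases} r_{\mathrm{SM}_n(S^{(d,s)})}(I) & \text{if } n+1\notin I,\\ r_{\mathrm{SM}_n(S)}(I\setminus\{n+1\})+d & \text{if } n+1\in I,\end{cases} \] is submodular, satisfies $z(\emptyset)=0$, and defines $\mathcal P(S^{(s)})$ in this way. -/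

import Mathlib

namespace OneColumn

/-- The positions `1, …, n` are modelled by `Fin n` (the position `p` is the element of value
`p - 1`). `GaleLE R S` is the componentwise order on subsets: `R` and `S` have the same size, and
the `k`-th smallest element of `R` does not exceed the `k`-th smallest element of `S`,
for every `k`. -/
def GaleLE {n : ℕ} (R S : Finset (Fin n)) : Prop :=
  ∃ h : R.card = S.card, ∀ k : Fin S.card, R.orderEmbOfFin h k ≤ S.orderEmbOfFin rfl k

open Classical in
/-- The set of bases of the Schubert matroid `SM_n(S)`: the sets `B ≤ S`. -/
noncomputable def schubertBases {n : ℕ} (S : Finset (Fin n)) : Finset (Finset (Fin n)) :=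
  Finset.univ.filter fun B => GaleLE B S

/-- The rank function of the Schubert matroid `SM_n(S)`:
`r(J) = max {#(J ∩ B) : B a basis}`. -/
noncomputable def schubertRank {n : ℕ} (S J : Finset (Fin n)) : ℕ :=
  (schubertBases S).sup fun B => (J ∩ B).card

/-- The empty positions of `T` before `s`. -/
def gaps {n : ℕ} (s : Fin n) (T : Finset (Fin n)) : Finset (Fin n) :=
  Finset.univ.filter fun i => i < s ∧ i ∉ T

/-- One filling step: add to `T` the largest position before `s` which is not in `T`
(`T` is left unchanged if there is none). -/
def fillStep {n : ℕ} (s : Fin n) (T : Finset (Fin n)) : Finset (Fin n) :=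
  if h : (gaps s T).Nonempty then insert ((gaps s T).max' h) T else T

/-- The diagram `S^{(k,s)}`, obtained from `S` by `k` filling steps. -/
def filled {n : ℕ} (S : Finset (Fin n)) (s : Fin n) : ℕ → Finset (Fin n)
  | 0 => S
  | k + 1 => fillStep s (filled S s k)

/-- The number `d = s - #{i ∈ S : i ≤ s}`, where `s` is counted from `1`. -/
def depth {n : ℕ} (S : Finset (Fin n)) (s : Fin n) : ℕ :=
  ((s : ℕ) + 1) - (S.filter fun i => i ≤ s).card

/-- The vector `(ζ^B, c)` in `ℝ^{n+1}`, with `ζ^B` the indicator vector of `B`. -/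
noncomputable def extIndicator {n : ℕ} (B : Finset (Fin n)) (c : ℝ) : Fin (n + 1) → ℝ :=
  Fin.snoc (α := fun _ => ℝ) (fun i : Fin n => if i ∈ B then (1 : ℝ) else 0) c

/-- The set of the vectors `(ζ^B, d - k)` with `B ≤ S^{(k,s)}` and `k ≤ d`. -/
def generators {n : ℕ} (S : Finset (Fin n)) (s : Fin n) : Set (Fin (n + 1) → ℝ) :=
  {t | ∃ k : ℕ, k ≤ depth S s ∧ ∃ B : Finset (Fin n), GaleLE B (filled S s k) ∧
    t = extIndicator B ((depth S s : ℝ) - (k : ℝ))}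

/-- The polytope `P(S^{(s)})`. -/
def polytope {n : ℕ} (S : Finset (Fin n)) (s : Fin n) : Set (Fin (n + 1) → ℝ) :=
  convexHull ℝ (generators S s)

/-- Submodularity of a real-valued set function. -/
def IsSubmodular {m : ℕ} (z : Finset (Fin m) → ℝ) : Prop :=
  ∀ I J : Finset (Fin m), z (I ∪ J) + z (I ∩ J) ≤ z I + z J

/-- The set of the `t` with `∑_{i ∈ I} t_i ≤ z(I)` for all `I`, with equality for the whole
index set. -/
def basePolytope {m : ℕ} (z : Finset (Fin m) → ℝ) : Set (Fin m → ℝ) :=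
  {t | (∀ I : Finset (Fin m), ∑ i ∈ I, t i ≤ z I) ∧ ∑ i, t i = z Finset.univ}

/-- A generalized permutahedron: a polytope (the convex hull of finitely many points) which is
the base polytope of a submodular function vanishing at the empty set. -/
def IsGeneralizedPermutahedron {m : ℕ} (P : Set (Fin m → ℝ)) : Prop :=
  (∃ F : Set (Fin m → ℝ), F.Finite ∧ P = convexHull ℝ F) ∧
    ∃ z : Finset (Fin m) → ℝ, IsSubmodular z ∧ z ∅ = 0 ∧ P = basePolytope z

/-- The points of `ℝ^m` with integer coordinates. -/
def integerPoints (m : ℕ) : Set (Fin m → ℝ) :=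
  {t | ∀ i, ∃ a : ℤ, t i = (a : ℝ)}

/-- The part of `I ⊆ {1, …, n+1}` that lies in `{1, …, n}`. -/
def dropLast {n : ℕ} (I : Finset (Fin (n + 1))) : Finset (Fin n) :=
  Finset.univ.filter fun i => i.castSucc ∈ I

/-- The set function with `z(I) = r_{SM_n(S^{(d,s)})}(I)` if `n + 1 ∉ I`, and
`z(I) = r_{SM_n(S)}(I \ {n + 1}) + d` if `n + 1 ∈ I`. -/
noncomputable def rankSetFunction {n : ℕ} (S : Finset (Fin n)) (s : Fin n)
    (I : Finset (Fin (n + 1))) : ℝ :=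
  if Fin.last n ∈ I then (schubertRank S (dropLast I) : ℝ) + (depth S s : ℝ)
  else (schubertRank (filled S s (depth S s)) (dropLast I) : ℝ)

end OneColumn

/-!
Edmonds' greedy algorithm shows that the base polytope of an integer-valued submodular function
is the convex hull of its integer points: a linear functional is maximized at the vertex obtained
by sorting the coordinates by decreasing weight, and this vertex has integer coordinates. So it is
enough to prove that `z` is submodular and that the integer points of its base polytope are the
generators.

Counting elements above a threshold turns both into arithmetic. With `tail T j = #{i ∈ T | j ≤ i}`,
one has `B ≤ T` if and only if `#B = #T` and `tail B j ≤ tail T j` for all `j`, and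
`r_{SM(T)}(J) = min_j (#{i ∈ J | i < j} + tail T j)`. Submodularity follows by uncrossing the two
minimizing thresholds. Filling adds the largest gaps first, so `tail S^{(k,s)} j` is the minimum of
`tail S j + k` and `tail S^{(d,s)} j`. These are the bounds that the inequalities for the sets
containing `n + 1` and for those not containing it impose on `tail B j`.
-/

namespace OneColumn

open Finset

section BasePolytope

variable {m : ℕ} {z : Finset (Fin m) → ℝ}

theorem apply_le_of_mem_basePolytope {t : Fin m → ℝ} (ht : t ∈ basePolytope z) (i : Fin m) :
    t i ≤ z {i} := by
  simpa using ht.1 {i}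

theorem sub_compl_le_apply_of_mem_basePolytope {t : Fin m → ℝ} (ht : t ∈ basePolytope z)
    (i : Fin m) : z univ - z {i}ᶜ ≤ t i := by
  have hsplit := sum_add_sum_compl {i} t
  rw [sum_singleton, ht.2] at hsplit
  linarith [ht.1 {i}ᶜ]

theorem convex_basePolytope (z : Finset (Fin m) → ℝ) : Convex ℝ (basePolytope z) := by
  intro x hx y hy a b ha hb hab
  have sum_combo (I : Finset (Fin m)) :
      ∑ i ∈ I, (a • x + b • y) i = a * ∑ i ∈ I, x i + b * ∑ i ∈ I, y i := by
    simp [sum_add_distrib, mul_sum]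
  refine ⟨fun I => ?_, ?_⟩
  · calc ∑ i ∈ I, (a • x + b • y) i = a * ∑ i ∈ I, x i + b * ∑ i ∈ I, y i := sum_combo I
      _ ≤ a * z I + b * z I := by gcongr; exacts [hx.1 I, hy.1 I]
      _ = z I := by rw [← add_mul, hab, one_mul]
  · rw [sum_combo, hx.2, hy.2, ← add_mul, hab, one_mul]

/-- The set `{σ 0, …, σ (k - 1)}` of the first `k` elements in the order `σ`; it is everything for
`k ≥ m`. -/
def prefixSet (σ : Equiv.Perm (Fin m)) (k : ℕ) : Finset (Fin m) :=
  {i | (σ.symm i : ℕ) < k}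

@[simp]
theorem prefixSet_zero (σ : Equiv.Perm (Fin m)) : prefixSet σ 0 = ∅ := by
  simp [prefixSet]

@[simp]
theorem prefixSet_self (σ : Equiv.Perm (Fin m)) : prefixSet σ m = univ := by
  simp [prefixSet]

theorem notMem_prefixSet (σ : Equiv.Perm (Fin m)) {k : ℕ} (hk : k < m) :
    σ ⟨k, hk⟩ ∉ prefixSet σ k := by
  simp [prefixSet]

theorem prefixSet_succ (σ : Equiv.Perm (Fin m)) {k : ℕ} (hk : k < m) :
    prefixSet σ (k + 1) = insert (σ ⟨k, hk⟩) (prefixSet σ k) := by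
  ext i
  have hi : i = σ ⟨k, hk⟩ ↔ (σ.symm i : ℕ) = k := by rw [← Equiv.symm_apply_eq, Fin.ext_iff]
  simp only [prefixSet, mem_filter, mem_univ, true_and, mem_insert, hi]
  omega

theorem sum_prefixSet_succ (σ : Equiv.Perm (Fin m)) {k : ℕ} (hk : k < m) (f : Fin m → ℝ) :
    ∑ i ∈ prefixSet σ (k + 1), f i = f (σ ⟨k, hk⟩) + ∑ i ∈ prefixSet σ k, f i := by
  rw [prefixSet_succ σ hk, sum_insert (notMem_prefixSet σ hk)]

/-- The vertex of the base polytope of `z` found by the greedy algorithm in the order `σ`. -/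
def greedyVertex (z : Finset (Fin m) → ℝ) (σ : Equiv.Perm (Fin m)) (i : Fin m) : ℝ :=
  z (prefixSet σ (σ.symm i + 1)) - z (prefixSet σ (σ.symm i))

theorem greedyVertex_apply (z : Finset (Fin m) → ℝ) (σ : Equiv.Perm (Fin m)) {k : ℕ}
    (hk : k < m) :
    greedyVertex z σ (σ ⟨k, hk⟩) = z (prefixSet σ (k + 1)) - z (prefixSet σ k) := by
  simp [greedyVertex]

theorem sum_prefixSet_greedyVertex (h0 : z ∅ = 0) (σ : Equiv.Perm (Fin m)) {k : ℕ} (hk : k ≤ m) :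
    ∑ i ∈ prefixSet σ k, greedyVertex z σ i = z (prefixSet σ k) := by
  induction k with
  | zero => simp [h0]
  | succ k ih => rw [sum_prefixSet_succ σ hk, greedyVertex_apply, ih (by omega), sub_add_cancel]

theorem sum_inter_prefixSet_greedyVertex_le (hz : IsSubmodular z) (h0 : z ∅ = 0)
    (σ : Equiv.Perm (Fin m)) (J : Finset (Fin m)) {k : ℕ} (hk : k ≤ m) :
    ∑ i ∈ J ∩ prefixSet σ k, greedyVertex z σ i ≤ z (J ∩ prefixSet σ k) := by
  induction k with
  | zero => simp [h0]
  | succ k ih =>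
    have hsucc := prefixSet_succ σ hk
    have hnot := notMem_prefixSet σ hk
    by_cases hJ : σ ⟨k, hk⟩ ∈ J
    · have hinter : J ∩ prefixSet σ (k + 1) = insert (σ ⟨k, hk⟩) (J ∩ prefixSet σ k) := by
        rw [hsucc, inter_insert_of_mem hJ]
      have hsub := hz (J ∩ prefixSet σ (k + 1)) (prefixSet σ k)
      have hunion : J ∩ prefixSet σ (k + 1) ∪ prefixSet σ k = prefixSet σ (k + 1) := by
        rw [hinter, hsucc, insert_union, union_eq_right.2 inter_subset_right]
      have hinter' : J ∩ prefixSet σ (k + 1) ∩ prefixSet σ k = J ∩ prefixSet σ k := by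
        rw [inter_assoc, hsucc, insert_inter_of_notMem hnot, inter_self]
      rw [hunion, hinter'] at hsub
      have hsum : ∑ i ∈ J ∩ prefixSet σ (k + 1), greedyVertex z σ i =
          greedyVertex z σ (σ ⟨k, hk⟩) + ∑ i ∈ J ∩ prefixSet σ k, greedyVertex z σ i := by
        rw [hinter, sum_insert fun h => hnot (mem_inter.1 h).2]
      linarith [ih (by omega), greedyVertex_apply z σ hk]
    · rw [hsucc, inter_insert_of_notMem hJ]
      exact ih (by omega)

theorem greedyVertex_mem_basePolytope (hz : IsSubmodular z) (h0 : z ∅ = 0)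
    (σ : Equiv.Perm (Fin m)) : greedyVertex z σ ∈ basePolytope z :=
  ⟨fun J => by simpa using sum_inter_prefixSet_greedyVertex_le hz h0 σ J le_rfl,
    by simpa using sum_prefixSet_greedyVertex h0 σ le_rfl⟩

theorem greedyVertex_mem_integerPoints (hint : ∀ I, ∃ a : ℤ, z I = a) (σ : Equiv.Perm (Fin m)) :
    greedyVertex z σ ∈ integerPoints m := fun i => by
  obtain ⟨a, ha⟩ := hint (prefixSet σ (σ.symm i + 1))
  obtain ⟨b, hb⟩ := hint (prefixSet σ (σ.symm i))
  exact ⟨a - b, by rw [greedyVertex, ha, hb, Int.cast_sub]⟩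

theorem mul_sum_prefixSet_le_sum_mul {σ : Equiv.Perm (Fin m)} {w a : Fin m → ℝ}
    (hw : Antitone (w ∘ σ)) (ha : ∀ k ≤ m, 0 ≤ ∑ i ∈ prefixSet σ k, a i) {k : ℕ} (hk : k ≤ m)
    {c : ℝ} (hc : ∀ i ∈ prefixSet σ k, c ≤ w i) :
    c * ∑ i ∈ prefixSet σ k, a i ≤ ∑ i ∈ prefixSet σ k, w i * a i := by
  induction k generalizing c with
  | zero => simp
  | succ k ih =>
    set e := σ ⟨k, hk⟩
    have hmin : ∀ i ∈ prefixSet σ k, w e ≤ w i := fun i hi => by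
      simpa [e] using hw (show σ.symm i ≤ ⟨k, hk⟩ from (mem_filter.1 hi).2.le)
    have hce : c ≤ w e := hc e (by rw [prefixSet_succ σ hk]; exact mem_insert_self _ _)
    calc c * ∑ i ∈ prefixSet σ (k + 1), a i
      _ ≤ w e * ∑ i ∈ prefixSet σ (k + 1), a i := mul_le_mul_of_nonneg_right hce (ha _ hk)
      _ = w e * a e + w e * ∑ i ∈ prefixSet σ k, a i := by rw [sum_prefixSet_succ σ hk, mul_add]
      _ ≤ w e * a e + ∑ i ∈ prefixSet σ k, w i * a i := by gcongr; exact ih (by omega) hmin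
      _ = ∑ i ∈ prefixSet σ (k + 1), w i * a i := (sum_prefixSet_succ σ hk fun i => w i * a i).symm

theorem sum_mul_le_sum_mul_greedyVertex (h0 : z ∅ = 0) {σ : Equiv.Perm (Fin m)} {w : Fin m → ℝ}
    (hw : Antitone (w ∘ σ)) {t : Fin m → ℝ} (ht : t ∈ basePolytope z) :
    ∑ i, w i * t i ≤ ∑ i, w i * greedyVertex z σ i := by
  have hpartial : ∀ k ≤ m, 0 ≤ ∑ i ∈ prefixSet σ k, (greedyVertex z σ i - t i) := fun k hk => by
    rw [sum_sub_distrib, sum_prefixSet_greedyVertex h0 σ hk, sub_nonneg]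
    exact ht.1 _
  have htotal : ∑ i, (greedyVertex z σ i - t i) = 0 := by
    rw [sum_sub_distrib, ht.2, sub_eq_zero]
    simpa using sum_prefixSet_greedyVertex h0 σ le_rfl
  obtain ⟨c, hc⟩ := (Set.finite_range w).bddBelow
  have key := mul_sum_prefixSet_le_sum_mul hw hpartial le_rfl fun i _ => hc ⟨i, rfl⟩
  simp only [prefixSet_self, htotal, mul_zero, mul_sub, sum_sub_distrib, sub_nonneg] at key
  exact key

theorem exists_apply_le_apply_greedyVertex (h0 : z ∅ = 0) (f : (Fin m → ℝ) →L[ℝ] ℝ) :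
    ∃ σ, ∀ t ∈ basePolytope z, f t ≤ f (greedyVertex z σ) := by
  have hf (x : Fin m → ℝ) : f x = ∑ i, f (Pi.single i 1) * x i := by
    conv_lhs => rw [pi_eq_sum_univ' x, map_sum]
    simp only [map_smul, smul_eq_mul, mul_comm]
  refine ⟨Tuple.sort fun i => -f (Pi.single i 1), fun t ht => ?_⟩
  rw [hf t, hf (greedyVertex z _)]
  refine sum_mul_le_sum_mul_greedyVertex h0 (fun i j hij => ?_) ht
  simpa using Tuple.monotone_sort (fun i => -f (Pi.single i 1)) hij

theorem convexHull_range_greedyVertex (hz : IsSubmodular z) (h0 : z ∅ = 0) :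
    convexHull ℝ (Set.range (greedyVertex z)) = basePolytope z := by
  refine (convexHull_min (Set.range_subset_iff.2 (greedyVertex_mem_basePolytope hz h0))
    (convex_basePolytope z)).antisymm fun t ht => ?_
  by_contra hnot
  obtain ⟨f, u, hfu, hut⟩ := geometric_hahn_banach_closed_point (convex_convexHull ℝ _)
    ((Set.finite_range (greedyVertex z)).isClosed_convexHull ℝ) hnot
  obtain ⟨σ, hσ⟩ := exists_apply_le_apply_greedyVertex h0 f
  exact ((hut.trans_le (hσ t ht)).trans (hfu _ (subset_convexHull ℝ _ ⟨σ, rfl⟩))).false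

theorem isGeneralizedPermutahedron_basePolytope (hz : IsSubmodular z) (h0 : z ∅ = 0) :
    IsGeneralizedPermutahedron (basePolytope z) :=
  ⟨⟨_, Set.finite_range _, (convexHull_range_greedyVertex hz h0).symm⟩, z, hz, h0, rfl⟩

theorem convexHull_basePolytope_inter_integerPoints (hz : IsSubmodular z) (h0 : z ∅ = 0)
    (hint : ∀ I, ∃ a : ℤ, z I = a) :
    convexHull ℝ (basePolytope z ∩ integerPoints m) = basePolytope z := by
  refine (convexHull_min Set.inter_subset_left (convex_basePolytope z)).antisymm ?_
  rw [← convexHull_range_greedyVertex hz h0]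
  refine convexHull_mono (Set.range_subset_iff.2 fun σ => ⟨?_, ?_⟩)
  · rw [convexHull_range_greedyVertex hz h0]
    exact greedyVertex_mem_basePolytope hz h0 σ
  · exact greedyVertex_mem_integerPoints hint σ

end BasePolytope

section Counting

variable {n : ℕ} {T A B : Finset (Fin n)}

/-- The number of elements of `T` which are at least `j`. The threshold is a natural number, so
that it can also lie above all positions. -/
def tailCard (T : Finset (Fin n)) (j : ℕ) : ℕ := #(T.filter fun i : Fin n => j ≤ (i : ℕ))

/-- The number of elements of `T` which are less than `j`, complementary to `tailCard T j`. -/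
def headCard (T : Finset (Fin n)) (j : ℕ) : ℕ := #(T.filter fun i : Fin n => (i : ℕ) < j)

theorem headCard_add_tailCard (T : Finset (Fin n)) (j : ℕ) :
    headCard T j + tailCard T j = #T := by
  simpa only [headCard, tailCard, not_lt] using
    card_filter_add_card_filter_not (s := T) (fun i : Fin n => (i : ℕ) < j)

@[simp]
theorem tailCard_zero (T : Finset (Fin n)) : tailCard T 0 = #T := by
  simp [tailCard]

@[simp]
theorem tailCard_self (T : Finset (Fin n)) : tailCard T n = 0 := by
  simp [tailCard, filter_eq_empty_iff]

@[simp]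
theorem headCard_zero (T : Finset (Fin n)) : headCard T 0 = 0 := by
  simp [headCard]

theorem tailCard_mono (h : A ⊆ B) (j : ℕ) : tailCard A j ≤ tailCard B j :=
  card_le_card (filter_subset_filter _ h)

theorem headCard_mono (h : A ⊆ B) (j : ℕ) : headCard A j ≤ headCard B j :=
  card_le_card (filter_subset_filter _ h)

theorem tailCard_antitone (T : Finset (Fin n)) : Antitone (tailCard T) := fun _ _ h =>
  card_le_card <| monotone_filter_right _ fun _ _ => h.trans

theorem tailCard_le_card (T : Finset (Fin n)) (j : ℕ) : tailCard T j ≤ #T :=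
  card_filter_le _ _

theorem tailCard_insert {a : Fin n} (ha : a ∉ T) (j : ℕ) :
    tailCard (insert a T) j = tailCard T j + if j ≤ (a : ℕ) then 1 else 0 := by
  unfold tailCard
  rw [filter_insert]
  split_ifs
  · exact card_insert_of_notMem (by simp [ha])
  · rfl

theorem min_one_tailCard (hT : T.Nonempty) (j : ℕ) :
    min 1 (tailCard T j) = if j ≤ (T.max' hT : ℕ) then 1 else 0 := by
  split_ifs with h
  · exact min_eq_left <| card_pos.2 ⟨T.max' hT, mem_filter.2 ⟨T.max'_mem hT, h⟩⟩
  · have hempty : tailCard T j = 0 := by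
      refine card_eq_zero.2 <| filter_eq_empty_iff.2 fun i hi hj => h (hj.trans ?_)
      exact T.le_max' i hi
    rw [hempty, Nat.min_zero]

theorem tailCard_erase_max' (hT : T.Nonempty) (j : ℕ) :
    tailCard (T.erase (T.max' hT)) j = tailCard T j - 1 := by
  have h := tailCard_insert (notMem_erase (T.max' hT) T) j
  rw [insert_erase (T.max'_mem hT), ← min_one_tailCard hT] at h
  omega

theorem card_inter_le_headCard_add_tailCard (J B : Finset (Fin n)) (j : ℕ) :
    #(J ∩ B) ≤ headCard J j + tailCard B j := by
  rw [← headCard_add_tailCard (J ∩ B) j]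
  exact add_le_add (headCard_mono inter_subset_left j) (tailCard_mono inter_subset_right j)

theorem headCard_union_add_headCard_inter_le (I J : Finset (Fin n)) {i j : ℕ} (h : i ≤ j) :
    headCard (I ∪ J) i + headCard (I ∩ J) j ≤ headCard I i + headCard J j := by
  unfold headCard
  rw [← card_union_add_card_inter (I.filter fun x : Fin n => (x : ℕ) < i),
    ← card_union_add_card_inter]
  refine add_le_add (card_le_card ?_) (card_le_card ?_) <;> intro x <;>
    simp only [mem_union, mem_inter, mem_filter] <;> grind

theorem tailCard_add_tailCard_le_of_subset (h : A ⊆ B) {i j : ℕ} (hij : j ≤ i) :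
    tailCard A j + tailCard B i ≤ tailCard A i + tailCard B j := by
  have hsplit (k : ℕ) : tailCard B k = tailCard A k + tailCard (B \ A) k := by
    unfold tailCard
    rw [← card_union_of_disjoint (disjoint_filter_filter disjoint_sdiff), ← filter_union,
      union_sdiff_of_subset h]
  have := tailCard_antitone (B \ A) hij
  rw [hsplit i, hsplit j]
  omega

theorem tailCard_eq_card_orderEmbOfFin {c : ℕ} (h : #T = c) (j : ℕ) :
    tailCard T j = #{k : Fin c | j ≤ (T.orderEmbOfFin h k : ℕ)} := by
  rw [tailCard, ← card_map (T.orderEmbOfFin h).toEmbedding]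
  conv_lhs => rw [← map_orderEmbOfFin_univ T h, filter_map]
  rfl

theorem galeLE_iff_tailCard_le {R S : Finset (Fin n)} :
    GaleLE R S ↔ #R = #S ∧ ∀ j, tailCard R j ≤ tailCard S j := by
  rw [GaleLE, ← exists_prop]
  refine exists_congr fun h => ?_
  simp only [tailCard_eq_card_orderEmbOfFin h, tailCard_eq_card_orderEmbOfFin (T := S) rfl]
  refine ⟨fun hle j => card_le_card ?_, fun htail k => ?_⟩
  · exact monotone_filter_right _ fun k _ hj => hj.trans (hle k)
  · by_contra! hlt
    refine (htail (R.orderEmbOfFin h k)).not_gt <| card_lt_card <| ssubset_iff_of_subset ?_ |>.2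
      ⟨k, by simp, by simpa using hlt⟩
    intro l hl
    simp only [mem_filter, mem_univ, true_and, Fin.val_fin_le, OrderEmbedding.le_iff_le] at hl ⊢
    by_contra! hlk
    exact ((S.orderEmbOfFin rfl).monotone hlk.le).not_gt (hlt.trans_le hl)

end Counting

section Rank

variable {n : ℕ} {T T' A J : Finset (Fin n)}

/-- The independent sets of the Schubert matroid `SM_n(T)`, described by their tails; the subsets
of bases are exactly these, see `exists_galeLE_superset`. -/
def IsSchubertIndep (T A : Finset (Fin n)) : Prop := ∀ j, tailCard A j ≤ tailCard T j

theorem exists_tailCard_eq_of_not_isSchubertIndep_insert (hA : IsSchubertIndep T A) {a : Fin n}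
    (ha : a ∉ A) (hins : ¬ IsSchubertIndep T (insert a A)) :
    ∃ j ≤ (a : ℕ), tailCard A j = tailCard T j := by
  simp only [IsSchubertIndep, not_forall, not_le, tailCard_insert ha] at hins
  obtain ⟨j, hj⟩ := hins
  have := hA j
  split_ifs at hj with hja
  · exact ⟨j, hja, by omega⟩
  · omega

theorem exists_card_eq_of_maximal (hA : Maximal (fun A => A ⊆ J ∧ IsSchubertIndep T A) A) :
    ∃ j, #A = headCard J j + tailCard T j := by
  obtain ⟨hAJ, hindep⟩ := hA.prop
  suffices ∃ j, tailCard A j = tailCard T j ∧ ∀ a ∈ J \ A, j ≤ (a : ℕ) by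
    obtain ⟨j, htight, hj⟩ := this
    have hhead : headCard J j = headCard A j := by
      refine (headCard_mono hAJ j).antisymm' <| card_le_card fun i hi => ?_
      rw [mem_filter] at hi ⊢
      refine ⟨?_, hi.2⟩
      by_contra hiA
      exact (hj i (mem_sdiff.2 ⟨hi.1, hiA⟩)).not_gt hi.2
    exact ⟨j, by rw [hhead, ← htight, headCard_add_tailCard]⟩
  rcases (J \ A).eq_empty_or_nonempty with hempty | hne
  · exact ⟨n, by simp, by simp [hempty]⟩
  · -- The threshold that blocks the smallest element of `J \ A` lies below all of them.
    obtain ⟨haJ, haA⟩ := mem_sdiff.1 ((J \ A).min'_mem hne)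
    obtain ⟨j, hj, htight⟩ := exists_tailCard_eq_of_not_isSchubertIndep_insert hindep haA fun h =>
      haA <| hA.le_of_ge ⟨insert_subset haJ hAJ, h⟩ (subset_insert _ _) (mem_insert_self _ _)
    exact ⟨j, htight, fun b hb => hj.trans ((J \ A).min'_le b hb)⟩

theorem exists_galeLE_superset (hA : IsSchubertIndep T A) : ∃ B, A ⊆ B ∧ GaleLE B T := by
  obtain ⟨B, hAB, hB⟩ := Finite.exists_le_maximal
    (p := fun B => B ⊆ univ ∧ IsSchubertIndep T B) ⟨subset_univ A, hA⟩
  obtain ⟨j, hj⟩ := exists_card_eq_of_maximal hB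
  refine ⟨B, hAB, galeLE_iff_tailCard_le.2 ⟨le_antisymm ?_ ?_, hB.prop.2⟩⟩
  · simpa using hB.prop.2 0
  · rw [hj, ← headCard_add_tailCard T j]
    exact Nat.add_le_add_right (headCard_mono (subset_univ T) j) _

theorem schubertRank_le_headCard_add_tailCard (T J : Finset (Fin n)) (j : ℕ) :
    schubertRank T J ≤ headCard J j + tailCard T j := by
  refine Finset.sup_le fun B hB => ?_
  have htail := (galeLE_iff_tailCard_le.1 (by simpa [schubertBases] using hB)).2 j
  exact (card_inter_le_headCard_add_tailCard J B j).trans (Nat.add_le_add_left htail _)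

theorem card_inter_le_schubertRank {B : Finset (Fin n)} (hB : GaleLE B T) (J : Finset (Fin n)) :
    #(J ∩ B) ≤ schubertRank T J :=
  Finset.le_sup (f := fun B => #(J ∩ B)) (by simpa [schubertBases] using hB)

theorem exists_schubertRank_eq_headCard_add_tailCard (T J : Finset (Fin n)) :
    ∃ j, schubertRank T J = headCard J j + tailCard T j := by
  obtain ⟨A, -, hA⟩ := Finite.exists_le_maximal (a := ∅)
    (p := fun A => A ⊆ J ∧ IsSchubertIndep T A)
    ⟨empty_subset J, by simp [IsSchubertIndep, tailCard]⟩
  obtain ⟨j, hj⟩ := exists_card_eq_of_maximal hA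
  obtain ⟨B, hAB, hBT⟩ := exists_galeLE_superset hA.prop.2
  refine ⟨j, (schubertRank_le_headCard_add_tailCard T J j).antisymm ?_⟩
  rw [← hj]
  exact (card_le_card (subset_inter hA.prop.1 hAB)).trans (card_inter_le_schubertRank hBT J)

theorem schubertRank_le_card (T J : Finset (Fin n)) : schubertRank T J ≤ #J :=
  Finset.sup_le fun _ _ => card_le_card inter_subset_left

theorem schubertRank_le_card_left (T J : Finset (Fin n)) : schubertRank T J ≤ #T := by
  simpa using schubertRank_le_headCard_add_tailCard T J 0

@[simp]
theorem schubertRank_empty (T : Finset (Fin n)) : schubertRank T ∅ = 0 := by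
  simpa using schubertRank_le_card T ∅

@[simp]
theorem schubertRank_univ (T : Finset (Fin n)) : schubertRank T univ = #T := by
  refine (schubertRank_le_card_left T univ).antisymm ?_
  simpa using card_inter_le_schubertRank (galeLE_iff_tailCard_le.2 ⟨rfl, fun _ => le_rfl⟩) univ

/-- For `T = T'` this is submodularity; in general it says that `SM_n(T)` is a quotient of
`SM_n(T')`. -/
theorem schubertRank_union_add_schubertRank_inter_le (h : T ⊆ T') (I J : Finset (Fin n)) :
    schubertRank T (I ∪ J) + schubertRank T' (I ∩ J) ≤ schubertRank T I + schubertRank T' J := by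
  obtain ⟨i, hi⟩ := exists_schubertRank_eq_headCard_add_tailCard T I
  obtain ⟨j, hj⟩ := exists_schubertRank_eq_headCard_add_tailCard T' J
  rcases le_total i j with hij | hji
  · have hhead := headCard_union_add_headCard_inter_le I J hij
    have hunion := schubertRank_le_headCard_add_tailCard T (I ∪ J) i
    have hinter := schubertRank_le_headCard_add_tailCard T' (I ∩ J) j
    omega
  · have hhead := headCard_union_add_headCard_inter_le J I hji
    rw [union_comm, inter_comm] at hhead
    have hunion := schubertRank_le_headCard_add_tailCard T (I ∪ J) j
    have hinter := schubertRank_le_headCard_add_tailCard T' (I ∩ J) i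
    have htail := tailCard_add_tailCard_le_of_subset h hji
    omega

theorem forall_card_inter_le_schubertRank_add_iff {B : Finset (Fin n)} {k : ℕ} :
    (∀ J, #(J ∩ B) ≤ schubertRank T J + k) ↔ ∀ j, tailCard B j ≤ tailCard T j + k := by
  refine ⟨fun h j => ?_, fun h J => ?_⟩
  · set J : Finset (Fin n) := {i | j ≤ (i : ℕ)} with hJ
    have htail : #(J ∩ B) = tailCard B j := by rw [tailCard, hJ, filter_inter, univ_inter]
    have hhead : headCard J j = 0 := by simp [headCard, hJ, filter_eq_empty_iff]
    have := schubertRank_le_headCard_add_tailCard T J j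
    have := h J
    omega
  · obtain ⟨j, hj⟩ := exists_schubertRank_eq_headCard_add_tailCard T J
    have := card_inter_le_headCard_add_tailCard J B j
    have := h j
    omega

end Rank

section Filling

variable {n : ℕ} {S : Finset (Fin n)} {s : Fin n}

theorem subset_fillStep (s : Fin n) (T : Finset (Fin n)) : T ⊆ fillStep s T := by
  unfold fillStep
  split_ifs
  · exact subset_insert _ _
  · rfl

theorem subset_filled (S : Finset (Fin n)) (s : Fin n) (k : ℕ) : S ⊆ filled S s k := by
  induction k with
  | zero => rfl
  | succ k ih => exact ih.trans (subset_fillStep s _)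

theorem tailCard_fillStep (s : Fin n) (T : Finset (Fin n)) (j : ℕ) :
    tailCard (fillStep s T) j = tailCard T j + min 1 (tailCard (gaps s T) j) := by
  by_cases h : (gaps s T).Nonempty
  · have hnot : (gaps s T).max' h ∉ T := (mem_filter.1 ((gaps s T).max'_mem h)).2.2
    rw [fillStep, dif_pos h, tailCard_insert hnot, min_one_tailCard h]
  · rw [fillStep, dif_neg h, not_nonempty_iff_eq_empty.1 h]
    simp [tailCard]

theorem tailCard_gaps_fillStep (s : Fin n) (T : Finset (Fin n)) (j : ℕ) :
    tailCard (gaps s (fillStep s T)) j = tailCard (gaps s T) j - 1 := by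
  by_cases h : (gaps s T).Nonempty
  · rw [← tailCard_erase_max' h, fillStep, dif_pos h]
    congr 1
    ext i
    simp only [gaps, mem_filter, mem_univ, true_and, mem_insert, mem_erase]
    tauto
  · rw [fillStep, dif_neg h, not_nonempty_iff_eq_empty.1 h]
    simp [tailCard]

theorem tailCard_gaps_filled (S : Finset (Fin n)) (s : Fin n) (k j : ℕ) :
    tailCard (gaps s (filled S s k)) j = tailCard (gaps s S) j - k := by
  induction k with
  | zero => rfl
  | succ k ih => rw [filled, tailCard_gaps_fillStep, ih, Nat.sub_sub]

theorem tailCard_filled (S : Finset (Fin n)) (s : Fin n) (k j : ℕ) :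
    tailCard (filled S s k) j = tailCard S j + min k (tailCard (gaps s S) j) := by
  induction k with
  | zero => simp [filled]
  | succ k ih =>
    rw [filled, tailCard_fillStep, ih, tailCard_gaps_filled]
    omega

theorem card_gaps (hs : s ∈ S) : #(gaps s S) = depth S s := by
  have hsplit := card_filter_add_card_filter_not (s := Iic s) (· ∈ S)
  have hmem : {i ∈ Iic s | i ∈ S} = {i ∈ S | i ≤ s} := by ext i; simp [and_comm]
  have hgaps : {i ∈ Iic s | i ∉ S} = gaps s S := by
    ext i
    simp only [gaps, mem_filter, mem_Iic, mem_univ, true_and, and_congr_left_iff]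
    exact fun hi => ⟨fun h => h.lt_of_ne fun h => hi (h ▸ hs), le_of_lt⟩
  rw [hmem, hgaps, Fin.card_Iic] at hsplit
  rw [depth]
  omega

theorem card_filled (hs : s ∈ S) {k : ℕ} (hk : k ≤ depth S s) : #(filled S s k) = #S + k := by
  have h := tailCard_filled S s k 0
  rwa [tailCard_zero, tailCard_zero, tailCard_zero, card_gaps hs, min_eq_left hk] at h

theorem tailCard_filled_eq_min (hs : s ∈ S) {k : ℕ} (hk : k ≤ depth S s) (j : ℕ) :
    tailCard (filled S s k) j =
      min (tailCard S j + k) (tailCard (filled S s (depth S s)) j) := by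
  have hgaps := tailCard_le_card (gaps s S) j
  rw [card_gaps hs] at hgaps
  rw [tailCard_filled, tailCard_filled]
  omega

end Filling

section RankSetFunction

variable {n : ℕ} {S : Finset (Fin n)} {s : Fin n}

@[simp]
theorem mem_dropLast {I : Finset (Fin (n + 1))} {i : Fin n} :
    i ∈ dropLast I ↔ i.castSucc ∈ I := by
  simp [dropLast]

@[simp]
theorem dropLast_univ : dropLast (univ : Finset (Fin (n + 1))) = univ := by
  ext; simp

@[simp]
theorem dropLast_map_castSuccEmb (J : Finset (Fin n)) :
    dropLast (J.map Fin.castSuccEmb) = J := by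
  ext; simp

@[simp]
theorem dropLast_insert_last (I : Finset (Fin (n + 1))) :
    dropLast (insert (Fin.last n) I) = dropLast I := by
  ext; simp [Fin.castSucc_ne_last]

theorem dropLast_union (I J : Finset (Fin (n + 1))) :
    dropLast (I ∪ J) = dropLast I ∪ dropLast J := by
  ext; simp

theorem dropLast_inter (I J : Finset (Fin (n + 1))) :
    dropLast (I ∩ J) = dropLast I ∩ dropLast J := by
  ext; simp

theorem rankSetFunction_of_last_mem (S : Finset (Fin n)) (s : Fin n) {I : Finset (Fin (n + 1))}
    (h : Fin.last n ∈ I) :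
    rankSetFunction S s I = schubertRank S (dropLast I) + depth S s :=
  if_pos h

theorem rankSetFunction_of_last_notMem (S : Finset (Fin n)) (s : Fin n)
    {I : Finset (Fin (n + 1))} (h : Fin.last n ∉ I) :
    rankSetFunction S s I = schubertRank (filled S s (depth S s)) (dropLast I) :=
  if_neg h

theorem isSubmodular_rankSetFunction (S : Finset (Fin n)) (s : Fin n) :
    IsSubmodular (rankSetFunction S s) := by
  intro I J
  have quotient {T T' : Finset (Fin n)} (h : T ⊆ T') (I J : Finset (Fin (n + 1))) :
      (schubertRank T (dropLast (I ∪ J)) + schubertRank T' (dropLast (I ∩ J)) : ℝ) ≤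
        schubertRank T (dropLast I) + schubertRank T' (dropLast J) := by
    rw [dropLast_union, dropLast_inter]
    exact_mod_cast schubertRank_union_add_schubertRank_inter_le h _ _
  have hIJ := quotient (subset_filled S s (depth S s)) I J
  have hJI := quotient (subset_filled S s (depth S s)) J I
  rw [union_comm, inter_comm] at hJI
  by_cases hI : Fin.last n ∈ I <;> by_cases hJ : Fin.last n ∈ J <;>
    simp only [rankSetFunction, mem_union, mem_inter, hI, hJ, or_self, and_self, or_true, and_true,
      and_false, if_true, if_false, or_false]
  · linarith [quotient (Subset.refl S) I J]
  · linarith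
  · linarith
  · linarith [quotient (Subset.refl (filled S s (depth S s))) I J]

theorem rankSetFunction_empty (S : Finset (Fin n)) (s : Fin n) : rankSetFunction S s ∅ = 0 := by
  simp [rankSetFunction, dropLast]

theorem rankSetFunction_univ (S : Finset (Fin n)) (s : Fin n) :
    rankSetFunction S s univ = #S + depth S s := by
  simp [rankSetFunction]

theorem exists_int_rankSetFunction_eq (S : Finset (Fin n)) (s : Fin n)
    (I : Finset (Fin (n + 1))) : ∃ a : ℤ, rankSetFunction S s I = a := by
  unfold rankSetFunction
  split_ifs
  · exact ⟨schubertRank S (dropLast I) + depth S s, by push_cast; rfl⟩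
  · exact ⟨schubertRank (filled S s (depth S s)) (dropLast I), by push_cast; rfl⟩

theorem sum_extIndicator (I : Finset (Fin (n + 1))) (B : Finset (Fin n)) (c : ℝ) :
    ∑ i ∈ I, extIndicator B c i = #(dropLast I ∩ B) + if Fin.last n ∈ I then c else 0 := by
  have hB : dropLast I ∩ B = univ.filter fun i => i.castSucc ∈ I ∧ i ∈ B := by ext; simp
  rw [← Fintype.sum_ite_mem I, Fin.sum_univ_castSucc, hB]
  simp [extIndicator, ← ite_and]

theorem extIndicator_mem_basePolytope_rankSetFunction_iff {B : Finset (Fin n)} {c : ℝ} :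
    extIndicator B c ∈ basePolytope (rankSetFunction S s) ↔
      #B + c = #S + depth S s ∧ (∀ J, #(J ∩ B) + c ≤ schubertRank S J + depth S s) ∧
        ∀ J, #(J ∩ B) ≤ schubertRank (filled S s (depth S s)) J := by
  have htotal : ∑ i, extIndicator B c i = #B + c := by simp [sum_extIndicator]
  rw [basePolytope, Set.mem_ofPred_eq, htotal, rankSetFunction_univ, and_comm]
  refine and_congr_right fun _ => ⟨fun h => ⟨fun J => ?_, fun J => ?_⟩, fun h I => ?_⟩
  · have hJ := h (insert (Fin.last n) (J.map Fin.castSuccEmb))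
    rwa [sum_extIndicator, rankSetFunction_of_last_mem S s (mem_insert_self _ _),
      dropLast_insert_last, dropLast_map_castSuccEmb, if_pos (mem_insert_self _ _)] at hJ
  · have hlast : Fin.last n ∉ J.map Fin.castSuccEmb := by simp [Fin.castSucc_ne_last]
    have hJ := h (J.map Fin.castSuccEmb)
    rw [sum_extIndicator, rankSetFunction_of_last_notMem S s hlast, dropLast_map_castSuccEmb,
      if_neg hlast, add_zero] at hJ
    exact_mod_cast hJ
  · rw [sum_extIndicator, rankSetFunction]
    split_ifs
    · exact h.1 _
    · rw [add_zero]
      exact_mod_cast h.2 _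

theorem extIndicator_mem_basePolytope_rankSetFunction_iff_galeLE (hs : s ∈ S) {k : ℕ}
    (hk : k ≤ depth S s) {B : Finset (Fin n)} :
    extIndicator B (depth S s - k) ∈ basePolytope (rankSetFunction S s) ↔
      GaleLE B (filled S s k) := by
  have hcard : (#B + (depth S s - k) : ℝ) = #S + depth S s ↔ #B = #S + k := by
    rw [← @Nat.cast_inj ℝ, Nat.cast_add]
    constructor <;> intro h <;> linarith
  have hwith (J : Finset (Fin n)) :
      (#(J ∩ B) + (depth S s - k) : ℝ) ≤ schubertRank S J + depth S s ↔
        #(J ∩ B) ≤ schubertRank S J + k := by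
    rw [← @Nat.cast_le ℝ, Nat.cast_add]
    constructor <;> intro h <;> linarith
  have hwithout := forall_card_inter_le_schubertRank_add_iff (T := filled S s (depth S s)) (B := B)
    (k := 0)
  simp only [add_zero] at hwithout
  simp only [extIndicator_mem_basePolytope_rankSetFunction_iff, hcard, hwith,
    forall_card_inter_le_schubertRank_add_iff, hwithout, galeLE_iff_tailCard_le, card_filled hs hk,
    tailCard_filled_eq_min hs hk, le_min_iff, forall_and]

theorem apply_castSucc_mem_Icc_of_mem_basePolytope {t : Fin (n + 1) → ℝ}
    (ht : t ∈ basePolytope (rankSetFunction S s)) (i : Fin n) :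
    t i.castSucc ∈ Set.Icc (0 : ℝ) 1 := by
  have hlower := sub_compl_le_apply_of_mem_basePolytope ht i.castSucc
  have hupper := apply_le_of_mem_basePolytope ht i.castSucc
  have hne := (Fin.castSucc_ne_last i).symm
  rw [rankSetFunction_univ, rankSetFunction_of_last_mem S s (by simpa using hne)] at hlower
  rw [rankSetFunction_of_last_notMem S s (by simpa using hne)] at hupper
  have hrank : (schubertRank S (dropLast {i.castSucc}ᶜ) : ℝ) ≤ #S :=
    Nat.cast_le.2 (schubertRank_le_card_left _ _)
  have hone : (schubertRank (filled S s (depth S s)) (dropLast {i.castSucc}) : ℝ) ≤ 1 := by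
    have hsingle : dropLast {i.castSucc} = {i} := by ext; simp
    rw [hsingle]
    exact_mod_cast schubertRank_le_card _ {i}
  constructor <;> linarith

theorem apply_last_mem_Icc_of_mem_basePolytope (hs : s ∈ S) {t : Fin (n + 1) → ℝ}
    (ht : t ∈ basePolytope (rankSetFunction S s)) :
    t (Fin.last n) ∈ Set.Icc (0 : ℝ) (depth S s) := by
  have hlower := sub_compl_le_apply_of_mem_basePolytope ht (Fin.last n)
  have hupper := apply_le_of_mem_basePolytope ht (Fin.last n)
  have hcompl : dropLast ({Fin.last n}ᶜ : Finset (Fin (n + 1))) = univ := by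
    ext; simp [Fin.castSucc_ne_last]
  have hsingle : dropLast ({Fin.last n} : Finset (Fin (n + 1))) = ∅ := by
    ext; simp [Fin.castSucc_ne_last]
  rw [rankSetFunction_univ, rankSetFunction_of_last_notMem S s (by simp), hcompl,
    schubertRank_univ, card_filled hs le_rfl, Nat.cast_add, sub_self] at hlower
  rw [rankSetFunction_of_last_mem S s (by simp), hsingle, schubertRank_empty, Nat.cast_zero,
    zero_add] at hupper
  exact ⟨hlower, hupper⟩

theorem exists_eq_extIndicator_of_mem_basePolytope (hs : s ∈ S) {t : Fin (n + 1) → ℝ}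
    (ht : t ∈ basePolytope (rankSetFunction S s)) (hint : t ∈ integerPoints (n + 1)) :
    ∃ k ≤ depth S s, ∃ B : Finset (Fin n), t = extIndicator B (depth S s - k) := by
  obtain ⟨c, hc⟩ := hint (Fin.last n)
  obtain ⟨hc0, hcd⟩ := apply_last_mem_Icc_of_mem_basePolytope hs ht
  rw [hc] at hc0 hcd
  norm_cast at hc0 hcd
  lift c to ℕ using hc0
  norm_cast at hc hcd
  refine ⟨depth S s - c, Nat.sub_le _ _, univ.filter fun i => t i.castSucc = 1, funext fun i => ?_⟩
  induction i using Fin.lastCases with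
  | last => simp [extIndicator, hc, Nat.cast_sub hcd]
  | cast i =>
    obtain ⟨a, ha⟩ := hint i.castSucc
    have hbounds := apply_castSucc_mem_Icc_of_mem_basePolytope ht i
    simp only [extIndicator, Fin.snoc_castSucc, mem_filter, mem_univ, true_and]
    rw [ha, Set.mem_Icc] at hbounds
    rw [ha]
    norm_cast at hbounds ⊢
    split_ifs <;> omega

theorem extIndicator_mem_integerPoints (B : Finset (Fin n)) (c : ℤ) :
    extIndicator B c ∈ integerPoints (n + 1) := fun i => by
  induction i using Fin.lastCases with
  | last => exact ⟨c, by simp [extIndicator]⟩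
  | cast i => exact ⟨if i ∈ B then 1 else 0, by simp [extIndicator]⟩

theorem generators_eq_basePolytope_inter_integerPoints (hs : s ∈ S) :
    generators S s = basePolytope (rankSetFunction S s) ∩ integerPoints (n + 1) := by
  ext t
  constructor
  · rintro ⟨k, hk, B, hB, rfl⟩
    refine ⟨(extIndicator_mem_basePolytope_rankSetFunction_iff_galeLE hs hk).2 hB, ?_⟩
    exact_mod_cast extIndicator_mem_integerPoints B (depth S s - k)
  · rintro ⟨ht, hint⟩
    obtain ⟨k, hk, B, rfl⟩ := exists_eq_extIndicator_of_mem_basePolytope hs ht hint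
    exact ⟨k, hk, B, (extIndicator_mem_basePolytope_rankSetFunction_iff_galeLE hs hk).1 ht, rfl⟩

end RankSetFunction

end OneColumn

theorem proposition4 (n : ℕ) (S : Finset (Fin n)) (s : Fin n) (hs : s ∈ S) :
    OneColumn.IsGeneralizedPermutahedron (OneColumn.polytope S s) ∧
    OneColumn.polytope S s ∩ OneColumn.integerPoints (n + 1) = OneColumn.generators S s ∧
    OneColumn.IsSubmodular (OneColumn.rankSetFunction S s) ∧
    OneColumn.rankSetFunction S s ∅ = 0 ∧
    OneColumn.polytope S s = OneColumn.basePolytope (OneColumn.rankSetFunction S s) := by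
  have hsub := OneColumn.isSubmodular_rankSetFunction S s
  have h0 := OneColumn.rankSetFunction_empty S s
  have hgen := OneColumn.generators_eq_basePolytope_inter_integerPoints hs
  have hpoly : OneColumn.polytope S s = OneColumn.basePolytope (OneColumn.rankSetFunction S s) := by
    rw [OneColumn.polytope, hgen]
    exact OneColumn.convexHull_basePolytope_inter_integerPoints hsub h0
      (OneColumn.exists_int_rankSetFunction_eq S s)
  rw [hpoly, hgen]
  exact ⟨OneColumn.isGeneralizedPermutahedron_basePolytope hsub h0, rfl, hsub, h0, rfl⟩
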